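/- Let $I=[0,1]$ and let $\gamma:I\to\mathbb{R}^d$ be piecewise $C^1$, i.e. continuous and such that $I$ is covered by finitely many closed intervals $T_1,\dots,T_k\subseteq I$ on the interiors of which $\gamma$ is $C^1$. Fix a unit vector $v\in S^{d-1}$. For $t\in\mathbb{R}$ let $$\mathrm{ECT}_\gamma(v,t):=\chi\big(\{x\in I:\langle\gamma(x),v\rangle\le t\}\big),\qquad \chi(X):=\sum_{k\ge 0}(-1)^k\,\mathrm{rank}\,H_k(X;\mathbb{Z}),$$ where $H_k(X;\mathbb{Z})$ denotes singular homology; $\chi(X)$ is defined when the total homology $\bigoplus_k H_k(X;\mathbb{Z})$ is finitely generated, and where it is not defined we set $\mathrm{ECT}_\gamma(v,t):=\infty$ (with $|\infty|=\infty$). Let $a$ and $b$ be the minimum and the maximum of $f(x):=\langle v,\gamma(x)\rangle$ on $I$. Then $t\mapsto|\mathrm{ECT}_\gamma(v,t)|\in[0,\infty]$ is measurable and $$\int_a^b|\mathrm{ECT}_\gamma(v,t)|\,\mathrm{d}t\;\le\;V(f):=\int_0^1|f'(s)|\,\mathrm{d}s,$$ both sides being integrals with values in $[0,\infty]$. Moreover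 $\mathrm{ECT}_\gamma(v,t)=1$ for all $t\ge b$, $\mathrm{ECT}_\gamma(v,t)=0$ for all $t<a$, and $\mathrm{ECT}_\gamma(v,t)$ is defined (i.e. is not $\infty$) for almost every $t\in\mathbb{R}$. -/

import Mathlib

open MeasureTheory
open scoped ENNReal unitInterval

noncomputable section

/-- The singular chain complex of a topological space with integer coefficients. -/
abbrev singularChains (X : Type) [TopologicalSpace X] : ChainComplex (ModuleCat.{0} ℤ) ℕ :=
  ((AlgebraicTopology.singularChainComplexFunctor (ModuleCat.{0} ℤ)).obj
    (ModuleCat.of ℤ ℤ)).obj (TopCat.of X)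

/-- The total singular homology of `X` with integer coefficients is finitely generated: every
homology group is finitely generated, and only finitely many of them are nonzero. -/
def HasFGHomology (X : Type) [TopologicalSpace X] : Prop :=
  (∀ k : ℕ, Module.Finite ℤ ((singularChains X).homology k)) ∧
    {k : ℕ | Nontrivial ((singularChains X).homology k)}.Finite

open Classical in
/-- The Euler characteristic `χ(X) = ∑ₖ (-1)ᵏ rank Hₖ(X; ℤ)` of a topological space with finitely
generated homology. The value is `⊤` (that is, `∞`) if `χ(X)` is not defined. -/
def eulerCharacteristic (X : Type) [TopologicalSpace X] : WithTop ℤ :=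
  if HasFGHomology X then
    ((∑ᶠ k : ℕ, (-1 : ℤ) ^ k * (Module.finrank ℤ ((singularChains X).homology k) : ℤ) : ℤ) :
      WithTop ℤ)
  else ⊤

/-- The Euler characteristic transform of a map `f : Z → ℝᵈ` on a topological space `Z`:
the Euler characteristic of `f⁻¹ {x | ⟨x, v⟩ ≤ t}` (with the subspace topology), with value `⊤`
where that is not defined. -/
def ECT {Z : Type} [TopologicalSpace Z] {d : ℕ} (f : Z → EuclideanSpace ℝ (Fin d))
    (v : Metric.sphere (0 : EuclideanSpace ℝ (Fin d)) 1) (t : ℝ) : WithTop ℤ :=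
  eulerCharacteristic (f ⁻¹' {x | inner ℝ x (v : EuclideanSpace ℝ (Fin d)) ≤ t})

/-- The absolute value `ℤ ∪ {∞} → [0, ∞]`, with `|∞| = ∞`. -/
def extAbs : WithTop ℤ → ℝ≥0∞
  | ⊤ => ⊤
  | (n : ℤ) => (n.natAbs : ℝ≥0∞)

/-- A map on the unit interval is piecewise `C¹` if it is continuous and `[0, 1]` is covered by
finitely many closed subintervals on the interiors of which the map is `C¹`. On such an interior
the map agrees with its extension `Set.IccExtend` to the real line. -/
def PiecewiseC1 {E : Type*} [NormedAddCommGroup E] [NormedSpace ℝ E] (γ : I → E) : Prop :=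
  Continuous γ ∧ ∃ (k : ℕ) (p q : Fin k → ℝ),
    (⋃ i, Set.Icc (p i) (q i)) = Set.Icc (0 : ℝ) 1 ∧
    ∀ i, ContDiffOn ℝ 1 (Set.IccExtend zero_le_one γ) (Set.Ioo (p i) (q i))

/-- The variation `∫₀¹ |f'(s)| ds` in `[0, ∞]` of a function `f` on the unit interval. -/
def variation (f : I → ℝ) : ℝ≥0∞ :=
  ∫⁻ s in Set.Ioo (0 : ℝ) 1, ENNReal.ofReal |deriv (Set.IccExtend zero_le_one f) s|

end

/-!
The sublevel sets `{f ≤ t}` of `f = ⟨γ, v⟩` are subsets of the unit interval, and the Euler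
characteristic of a subset `S` of the unit interval is its number of components, with value `∞` if
there are infinitely many (`extAbs_eulerCharacteristic`). Indeed two points of `S` lie in the same
component if and only if `S` contains the interval between them, so that components and path
components agree and `H₀(S)` is free on the components. If their number is infinite, `H₀(S)` is not
finitely generated. If it is finite, the components are open in `S`, and moving every point along a
straight line to a base point of its component shows that the identity of `S` is homotopic to a map
that factors through a discrete space; hence the homology vanishes in positive degrees.

The number of components is measurable in `t` because having at least `n` components can be
expressed by countably many conditions, each of which holds for an interval of levels `t`: there
are `n` points of `S` separated by rational points outside `S` (`le_card_components_sublevel_iff`).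

If `t < max f`, then each component of `{f ≤ t}` contains a point of `{f = t}`
(`exists_level_uIcc_subset`), so the number of components is at most the number of points of
`{f = t}`. The integral of the latter is at most `∫ |f'|`, by the inequality that is the easy half
of the area formula (`lintegral_encard_level_le`). Almost every level set is finite by Sard's
theorem and compactness (`ae_finite_level`), even where `∫ |f'|` is infinite. For both results it is
enough that `f` is continuous, and differentiable outside a finite set.
-/

/-! ### Components of subsets of the unit interval -/

/-- Two maps into a subset `S` of the unit interval are homotopic in `S`, by the straight-line
homotopy, if `S` contains the interval between any two corresponding values. -/
theorem homotopic_of_uIcc_subset {Y : Type*} [TopologicalSpace Y] {S : Set I} (g h : C(Y, S))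
    (hgh : ∀ y, Set.uIcc (g y : I) (h y) ⊆ S) : g.Homotopic h := by
  let φ : I × Y → ℝ := fun p ↦ (1 - (p.1 : ℝ)) * (g p.2 : I) + (p.1 : ℝ) * (h p.2 : I)
  have hφ : Continuous φ := by fun_prop
  have hseg : ∀ p : I × Y, φ p ∈ Set.uIcc ((g p.2 : I) : ℝ) ((h p.2 : I) : ℝ) := fun p ↦ by
    rw [← segment_eq_uIcc]
    exact ⟨1 - p.1, p.1, sub_nonneg.2 p.1.2.2, p.1.2.1, by ring, by simp [φ]⟩
  have hI : ∀ p, φ p ∈ I := fun p ↦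
    Set.OrdConnected.uIcc_subset Set.ordConnected_Icc (g p.2 : I).2 (h p.2 : I).2 (hseg p)
  have hS : ∀ p, (⟨φ p, hI p⟩ : I) ∈ S := fun p ↦ by
    refine hgh p.2 ?_
    have := hseg p
    rw [Set.mem_uIcc] at this ⊢
    exact this
  exact ⟨{ toFun := fun p ↦ ⟨⟨φ p, hI p⟩, hS p⟩
           continuous_toFun := by fun_prop
           map_zero_left := fun y ↦ by ext; simp [φ]
           map_one_left := fun y ↦ by ext; simp [φ] }⟩

theorem joined_of_uIcc_subset {S : Set I} {x y : S} (h : Set.uIcc (x : I) y ⊆ S) :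
    Joined x y := by
  obtain ⟨H⟩ := homotopic_of_uIcc_subset (ContinuousMap.const Unit x) (ContinuousMap.const Unit y)
    fun _ ↦ h
  exact ⟨H.evalAt ()⟩

theorem connectedComponents_mk_eq_iff {S : Set I} {x y : S} :
    (ConnectedComponents.mk x = ConnectedComponents.mk y) ↔ Set.uIcc (x : I) y ⊆ S := by
  constructor
  · intro h
    have hxy : x ∈ connectedComponent y := ConnectedComponents.coe_eq_coe'.1 h
    have hc : (Subtype.val '' connectedComponent y).OrdConnected :=
      ((isPreconnected_connectedComponent (x := y)).image _
        continuous_subtype_val.continuousOn).ordConnected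
    refine (hc.uIcc_subset ⟨x, hxy, rfl⟩ ⟨y, mem_connectedComponent, rfl⟩).trans ?_
    rintro _ ⟨z, -, rfl⟩
    exact z.2
  · intro h
    rw [ConnectedComponents.coe_eq_coe']
    exact pathComponent_subset_component _ (joined_of_uIcc_subset h).symm

/-- Path components and components of a subset of the unit interval agree. -/
noncomputable def zerothHomotopyEquivConnectedComponents (S : Set I) :
    ZerothHomotopy S ≃ ConnectedComponents S :=
  Equiv.ofBijective ZerothHomotopy.toConnectedComponents
    ⟨fun a b ↦ by
      induction a with | mk x => induction b with | mk y =>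
      intro h
      obtain ⟨p⟩ := joined_of_uIcc_subset (connectedComponents_mk_eq_iff.1 h)
      exact ZerothHomotopy.sound p, ZerothHomotopy.toConnectedComponents_surjective⟩

/-! ### The Euler characteristic of a subset of the unit interval -/

open CategoryTheory in
/-- If the identity of `X` is homotopic to a map that factors through a totally disconnected
space, then the homology of `X` vanishes in positive degrees. -/
theorem subsingleton_homology_of_homotopic_comp {X P : Type} [TopologicalSpace X]
    [TopologicalSpace P] [TotallyDisconnectedSpace P] (r : C(X, P)) (s : C(P, X))
    (h : (ContinuousMap.id X).Homotopic (s.comp r)) {k : ℕ} (hk : k ≠ 0) :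
    Subsingleton ((singularChains X).homology k) := by
  obtain ⟨H⟩ := h
  let F := (AlgebraicTopology.singularHomologyFunctor (ModuleCat.{0} ℤ) k).obj (ModuleCat.of ℤ ℤ)
  have hP : Limits.IsZero (F.obj (TopCat.of P)) :=
    haveI : TotallyDisconnectedSpace (TopCat.of P) := ‹TotallyDisconnectedSpace P›
    AlgebraicTopology.isZero_singularHomologyFunctor_of_totallyDisconnectedSpace _ k _ _ hk
  have hmap : F.map (𝟙 (TopCat.of X)) = F.map (TopCat.ofHom r ≫ TopCat.ofHom s) :=
    TopCat.Homotopy.congr_homologyMap_singularChainComplexFunctor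
      (f := 𝟙 (TopCat.of X)) (g := TopCat.ofHom r ≫ TopCat.ofHom s) H (ModuleCat.of ℤ ℤ) k
  have hX : Limits.IsZero (F.obj (TopCat.of X)) := by
    rw [Limits.IsZero.iff_id_eq_zero, ← F.map_id, hmap, F.map_comp, hP.eq_zero_of_tgt (F.map _),
      Limits.zero_comp]
  exact ModuleCat.subsingleton_of_isZero hX

theorem subsingleton_homology_of_finite_connectedComponents (S : Set I)
    [Finite (ConnectedComponents S)] {k : ℕ} (hk : k ≠ 0) :
    Subsingleton ((singularChains S).homology k) := by
  have hs := ConnectedComponents.surjective_coe (α := S)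
  refine subsingleton_homology_of_homotopic_comp
    (⟨_, ConnectedComponents.continuous_coe⟩ : C(S, ConnectedComponents S))
    ⟨Function.surjInv hs, continuous_of_discreteTopology⟩
    (homotopic_of_uIcc_subset _ _ fun y ↦ ?_) hk
  exact connectedComponents_mk_eq_iff.1 (Function.surjInv_eq hs _).symm

open CategoryTheory in
open scoped DirectSum in
/-- The zeroth homology of a subset of the unit interval is free on its components. -/
noncomputable def homologyZeroEquiv (S : Set I) :
    (singularChains S).homology 0 ≃ₗ[ℤ] (_root_.ConnectedComponents S →₀ ℤ) :=
  haveI := Classical.decEq (ZerothHomotopy S)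
  (((TopCat.singularHomology₀Iso (TopCat.of S) (ModuleCat.of ℤ ℤ)) ≪≫
    ModuleCat.coprodIsoDirectSum (R := ℤ) (fun _ : ZerothHomotopy S ↦
      ModuleCat.of ℤ ℤ)).toLinearEquiv).trans
  ((finsuppLEquivDirectSum ℤ ℤ (ZerothHomotopy S)).symm.trans
    (Finsupp.domLCongr (zerothHomotopyEquivConnectedComponents S)))

theorem finite_homology_zero_iff (S : Set I) :
    Module.Finite ℤ ((singularChains S).homology 0) ↔ Finite (ConnectedComponents S) := by
  rw [Module.Finite.equiv_iff (homologyZeroEquiv S), Module.finite_finsupp_iff]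
  constructor
  · rintro (h | h | h)
    · infer_instance
    · exact absurd h (not_subsingleton ℤ)
    · exact h.2
  · exact fun h ↦ .inr (.inr ⟨inferInstance, h⟩)

theorem hasFGHomology_iff (S : Set I) : HasFGHomology S ↔ Finite (ConnectedComponents S) := by
  refine ⟨fun h ↦ (finite_homology_zero_iff S).1 (h.1 0), fun h ↦ ⟨fun k ↦ ?_, ?_⟩⟩
  · rcases eq_or_ne k 0 with rfl | hk
    · exact (finite_homology_zero_iff S).2 h
    · have := subsingleton_homology_of_finite_connectedComponents S hk
      infer_instance
  · refine (Set.finite_singleton 0).subset fun k hk ↦ ?_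
    by_contra hk0
    have := subsingleton_homology_of_finite_connectedComponents S hk0
    exact not_nontrivial _ hk

theorem eulerCharacteristic_of_finite (S : Set I) [h : Finite (ConnectedComponents S)] :
    eulerCharacteristic S = ((Nat.card (ConnectedComponents S) : ℤ) : WithTop ℤ) := by
  rw [eulerCharacteristic, if_pos ((hasFGHomology_iff S).2 h), finsum_eq_single _ 0]
  · have := Fintype.ofFinite (ConnectedComponents S)
    rw [(homologyZeroEquiv S).finrank_eq]
    simp
  · intro k hk
    have := subsingleton_homology_of_finite_connectedComponents S hk
    rw [Module.finrank_zero_of_subsingleton]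
    simp

theorem eulerCharacteristic_of_infinite (S : Set I) [h : Infinite (ConnectedComponents S)] :
    eulerCharacteristic S = ⊤ := by
  rw [eulerCharacteristic, if_neg]
  rwa [hasFGHomology_iff, not_finite_iff_infinite]

theorem extAbs_eulerCharacteristic (S : Set I) :
    extAbs (eulerCharacteristic S) = (ENat.card (ConnectedComponents S) : ℝ≥0∞) := by
  rcases finite_or_infinite (ConnectedComponents S) with h | h
  · rw [eulerCharacteristic_of_finite, ENat.card_eq_coe_natCard]
    simp [extAbs]
  · rw [eulerCharacteristic_of_infinite, ENat.card_eq_top_of_infinite]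
    rfl

/-! ### Counting the components of sublevel sets -/

/-- A sublevel set that is not the whole unit interval has a point of the level set in each of its
components: the point of the level set nearest to a given point of the component. -/
theorem exists_level_uIcc_subset {f : I → ℝ} (hf : Continuous f) {t : ℝ} {x z : I}
    (hx : f x ≤ t) (hz : t < f z) :
    ∃ e, f e = t ∧ Set.uIcc x e ⊆ {y | f y ≤ t} := by
  have hK : IsCompact {e | f e = t} := (isClosed_eq hf continuous_const).isCompact
  obtain ⟨e₀, he₀⟩ := mem_range_of_exists_le_of_exists_ge hf ⟨x, hx⟩ ⟨z, hz.le⟩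
  obtain ⟨e, he, hmin⟩ := hK.exists_isMinOn ⟨e₀, he₀⟩
    (f := fun e ↦ dist x e) (by fun_prop)
  refine ⟨e, he, fun w hw ↦ ?_⟩
  by_contra! hwt
  simp only [Set.mem_ofPred_eq, not_le] at hwt
  obtain ⟨e', he', hfe'⟩ : t ∈ f '' Set.uIcc x w :=
    intermediate_value_uIcc hf.continuousOn (Set.mem_uIcc.2 (.inl ⟨hx, hwt.le⟩))
  have hmin' : dist x e ≤ dist x e' := hmin hfe'
  have hne : w ≠ e := by rintro rfl; exact hwt.ne' he
  -- `e'` lies between `x` and `w`, and `w` strictly between `x` and `e`.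
  rw [Subtype.dist_eq, Subtype.dist_eq, Real.dist_eq, Real.dist_eq] at hmin'
  rw [Set.mem_uIcc] at hw he'
  apply hne
  simp only [← Subtype.coe_le_coe] at hw he'
  apply Subtype.ext
  rcases hw with ⟨h1, h2⟩ | ⟨h1, h2⟩ <;> rcases he' with ⟨h3, h4⟩ | ⟨h3, h4⟩ <;>
    rcases abs_cases ((x : ℝ) - e) with ⟨h5, h5'⟩ | ⟨h5, h5'⟩ <;>
    rcases abs_cases ((x : ℝ) - e') with ⟨h6, h6'⟩ | ⟨h6, h6'⟩ <;> linarith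

theorem card_components_sublevel_le {f : I → ℝ} (hf : Continuous f) {t : ℝ}
    (ht : ∃ z, t < f z) :
    ENat.card (ConnectedComponents {x | f x ≤ t}) ≤ {x | f x = t}.encard := by
  obtain ⟨z, hz⟩ := ht
  let g : {x | f x = t} → ConnectedComponents {x | f x ≤ t} := fun e ↦
    ConnectedComponents.mk ⟨e, e.2.le⟩
  suffices hg : Function.Surjective g from
    ENat.card_le_card_of_injective (Function.injective_surjInv hg)
  intro c
  obtain ⟨x, rfl⟩ := ConnectedComponents.surjective_coe c
  obtain ⟨e, he, hxe⟩ := exists_level_uIcc_subset hf x.2 hz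
  refine ⟨⟨e, he⟩, (connectedComponents_mk_eq_iff.2 ?_).symm⟩
  exact hxe

/-- A sublevel set has at least `n` components if and only if it contains points
`x 0 < ⋯ < x (n - 1)` such that any two of them are separated by a rational number at which the
function exceeds the level. -/
theorem le_card_components_sublevel_iff {f : I → ℝ} (hf : Continuous f) (t : ℝ) (n : ℕ) :
    (n : ℕ∞) ≤ ENat.card (ConnectedComponents {x | f x ≤ t}) ↔
      ∃ q : Fin n → Fin n → ℚ,
        (∀ i j, i < j → t < Set.IccExtend zero_le_one f (q i j)) ∧
        ∀ i, ∃ x : I, f x ≤ t ∧ (∀ j, i < j → (x : ℝ) < q i j) ∧ ∀ j, j < i → (q j i : ℝ) < x := by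
  constructor
  · intro h
    obtain ⟨s, hs⟩ : ∃ s : Finset (ConnectedComponents {x | f x ≤ t}), s.card = n := by
      rw [← Set.encard_univ] at h
      obtain ⟨s, -, hs⟩ := Set.exists_subset_encard_eq h
      have hfin : s.Finite := Set.finite_of_encard_eq_coe hs
      refine ⟨hfin.toFinset, ?_⟩
      rw [hfin.encard_eq_coe_toFinset_card] at hs
      exact_mod_cast hs
    have hsurj := ConnectedComponents.surjective_coe (α := {x | f x ≤ t})
    have hinj := Function.injective_surjInv hsurj
    let x := (s.map ⟨_, hinj⟩).orderEmbOfFin ((Finset.card_map _).trans hs)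
    -- Distinct points among the `x i` lie in distinct components.
    have hx : ∀ i j, i < j → ∃ q : ℚ, t < Set.IccExtend zero_le_one f (q : ℝ) ∧
        ((x i : I) : ℝ) < q ∧ (q : ℝ) < (x j : I) := by
      intro i j hij
      have hlt : x i < x j := x.strictMono hij
      obtain ⟨ci, -, hci⟩ := Finset.mem_map.1 (Finset.orderEmbOfFin_mem _ _ i : x i ∈ _)
      obtain ⟨cj, -, hcj⟩ := Finset.mem_map.1 (Finset.orderEmbOfFin_mem _ _ j : x j ∈ _)
      have hne : ConnectedComponents.mk (x i) ≠ ConnectedComponents.mk (x j) := by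
        rw [← hci, ← hcj]
        simp only [Function.Embedding.coeFn_mk]
        rw [Function.surjInv_eq hsurj, Function.surjInv_eq hsurj]
        rintro rfl
        exact hlt.ne (hci.symm.trans hcj)
      rw [Ne, connectedComponents_mk_eq_iff, Set.not_subset] at hne
      obtain ⟨w, hw, hwt⟩ := hne
      rw [Set.uIcc_of_le (show ((x i : I)) ≤ x j from hlt.le)] at hw
      simp only [Set.mem_ofPred_eq, not_le] at hwt
      have hw1 : ((x i : I) : ℝ) < w := lt_of_le_of_ne hw.1 (by
        intro h; rw [← Subtype.ext h] at hwt; exact hwt.not_ge (x i).2)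
      have hw2 : (w : ℝ) < (x j : I) := lt_of_le_of_ne hw.2 (by
        intro h; rw [Subtype.ext h] at hwt; exact hwt.not_ge (x j).2)
      have hopen : IsOpen (Set.Ioo ((x i : I) : ℝ) (x j : I) ∩
          Set.IccExtend zero_le_one f ⁻¹' Set.Ioi t) :=
        isOpen_Ioo.inter (isOpen_Ioi.preimage hf.Icc_extend')
      obtain ⟨q, hq⟩ := Rat.denseRange_cast.exists_mem_open hopen
        ⟨w, ⟨hw1, hw2⟩, by simpa [Set.IccExtend_val] using hwt⟩
      exact ⟨q, hq.2, hq.1.1, hq.1.2⟩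
    choose q hq using hx
    refine ⟨fun i j ↦ if h : i < j then q i j h else 0, fun i j hij ↦ ?_, fun i ↦
      ⟨x i, (x i).2, fun j hij ↦ ?_, fun j hij ↦ ?_⟩⟩ <;> simp only [hij, dite_true]
    · exact (hq i j hij).1
    · exact (hq i j hij).2.1
    · exact (hq j i hij).2.2
  · rintro ⟨q, hq, hx⟩
    choose x hxt hxl hxr using hx
    have hinj : Function.Injective fun i ↦
        ConnectedComponents.mk (⟨x i, hxt i⟩ : {x | f x ≤ t}) := by
      refine .of_lt_imp_ne fun i j hij h ↦ ?_
      have h1 := hxl i j hij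
      have h2 := hxr j i hij
      have hmem : (q i j : ℝ) ∈ I :=
        ⟨(x i).2.1.trans h1.le, h2.le.trans (x j).2.2⟩
      have h3 := connectedComponents_mk_eq_iff.1 h
        (Set.mem_uIcc.2 (.inl ⟨h1.le, h2.le⟩) : (⟨q i j, hmem⟩ : I) ∈ _)
      have h4 := hq i j hij
      rw [Set.IccExtend_of_mem _ _ hmem] at h4
      exact h4.not_ge h3
    have hcard : (n : ℕ∞) = ENat.card (Fin n) := by simp
    exact hcard ▸ ENat.card_le_card_of_injective hinj

theorem measurable_card_components_sublevel {f : I → ℝ} (hf : Continuous f) :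
    Measurable fun t : ℝ ↦ ENat.card (ConnectedComponents {x | f x ≤ t}) := by
  have hle : ∀ n : ℕ, MeasurableSet
      {t : ℝ | (n : ℕ∞) ≤ ENat.card (ConnectedComponents {x | f x ≤ t})} := fun n ↦ by
    simp only [le_card_components_sublevel_iff hf, Set.ofPred_exists, Set.ofPred_and,
      Set.ofPred_forall]
    refine .iUnion fun q ↦ .inter (.iInter fun i ↦ .iInter fun j ↦ .iInter fun _ ↦
      measurableSet_Iio) (.iInter fun i ↦ ?_)
    simp only [← Set.ofPred_and, ← Set.ofPred_exists, ← Set.ofPred_forall]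
    refine (IsUpperSet.ordConnected ?_).measurableSet
    exact fun t t' htt' ⟨x, hx, h⟩ ↦ ⟨x, hx.trans htt', h⟩
  refine ENat.measurable_iff.2 fun n ↦ ?_
  convert (hle n).diff (hle (n + 1)) using 1
  ext t
  simp only [Set.mem_preimage, Set.mem_singleton_iff, Set.mem_sdiff, Set.mem_ofPred_eq, not_le]
  rw [Nat.cast_add, Nat.cast_one, ENat.lt_add_one_iff (by simp), le_antisymm_iff, and_comm]

/-! ### Level sets of differentiable functions of one variable -/

open Filter in
/-- The integral of the number of points of the level sets is at most the integral of the absolute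
value of the derivative. The fibres of `x ↦ ⌊n * x⌋` cut `s` into pieces; the number of pieces
whose image contains `t` has the right integral, and for large `n` it exceeds the number of points
of any given finite subset of the level set of `t`, so that Fatou's lemma applies. -/
theorem lintegral_encard_level_le {F F' : ℝ → ℝ} {s : Set ℝ} (hs : MeasurableSet s)
    (hF : ∀ x ∈ s, HasDerivWithinAt F (F' x) s x) :
    ∫⁻ t, ({x | x ∈ s ∧ F x = t}.encard : ℝ≥0∞) ≤ ∫⁻ x in s, ENNReal.ofReal |F' x| := by
  let J : ℕ → ℤ → Set ℝ := fun n j ↦ s ∩ {x | ⌊(n : ℝ) * x⌋ = j}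
  have hJ : ∀ n j, MeasurableSet (J n j) := fun n j ↦
    hs.inter (measurableSet_eq_fun (by fun_prop) measurable_const)
  -- The measurable hulls avoid the question whether the images are measurable.
  let c : ℕ → ℝ → ℝ≥0∞ := fun n t ↦
    ∑' j, (toMeasurable volume (F '' J n j)).indicator (fun _ ↦ 1) t
  have hcm : ∀ n, Measurable (c n) := fun n ↦
    .tsum fun j ↦ measurable_const.indicator (measurableSet_toMeasurable _ _)
  have hc : ∀ n, ∫⁻ t, c n t ≤ ∫⁻ x in s, ENNReal.ofReal |F' x| := by
    intro n
    have hcover : s = ⋃ j, J n j := by ext x; simp [J]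
    calc ∫⁻ t, c n t = ∑' j, volume (F '' J n j) := by
          rw [lintegral_tsum fun j ↦
            (measurable_const.indicator (measurableSet_toMeasurable _ _)).aemeasurable]
          simp [lintegral_indicator (measurableSet_toMeasurable _ _)]
      _ ≤ ∑' j, ∫⁻ x in J n j, ENNReal.ofReal |F' x| := by
          refine ENNReal.tsum_le_tsum fun j ↦ ?_
          have := addHaar_image_le_lintegral_abs_det_fderiv volume (hJ n j)
            fun x hx ↦ ((hF x hx.1).mono Set.inter_subset_left).hasFDerivWithinAt
          simpa using this
      _ = ∫⁻ x in s, ENNReal.ofReal |F' x| := by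
          conv_rhs => rw [hcover]
          refine (lintegral_iUnion (hJ n) (fun i j hij ↦ ?_) _).symm
          exact Set.disjoint_left.2 fun x hi hj ↦ hij (hi.2.symm.trans hj.2)
  have hfin : ∀ (t : ℝ) (T : Finset ℝ), (∀ x ∈ T, x ∈ s ∧ F x = t) →
      (T.card : ℝ≥0∞) ≤ liminf (fun n ↦ c n t) atTop := by
    intro t T hT
    have hinj : ∀ᶠ n : ℕ in atTop, ∀ x ∈ T, ∀ y ∈ T, x ≠ y → ⌊(n : ℝ) * x⌋ ≠ ⌊(n : ℝ) * y⌋ := by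
      refine (eventually_all_finset T).2 fun x _ ↦ (eventually_all_finset T).2 fun y _ ↦ ?_
      by_cases hxy : x = y
      · simp [hxy]
      have hpos : 0 < |x - y| := abs_pos.2 (sub_ne_zero.2 hxy)
      filter_upwards [(tendsto_natCast_atTop_atTop.atTop_mul_const hpos).eventually_ge_atTop 1]
        with n hn _ h
      have := Int.abs_sub_lt_one_of_floor_eq_floor h
      rw [← mul_sub, abs_mul, Nat.abs_cast] at this
      exact this.not_ge hn
    refine le_liminf_of_le (by isBoundedDefault) (hinj.mono fun n hn ↦ ?_)
    let φ : ℝ → ℤ := fun x ↦ ⌊(n : ℝ) * x⌋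
    have hφ : Set.InjOn φ T := fun x hx y hy h ↦ by_contra fun hxy ↦ hn x hx y hy hxy h
    calc (T.card : ℝ≥0∞) = ∑ j ∈ T.image φ, 1 := by
          rw [Finset.sum_const, Finset.card_image_of_injOn hφ]; simp
      _ ≤ ∑ j ∈ T.image φ, (toMeasurable volume (F '' J n j)).indicator (fun _ ↦ 1) t := by
          refine Finset.sum_le_sum fun j hj ↦ ?_
          obtain ⟨x, hx, rfl⟩ := Finset.mem_image.1 hj
          rw [Set.indicator_of_mem]
          exact subset_toMeasurable _ _ ⟨x, ⟨(hT x hx).1, rfl⟩, (hT x hx).2⟩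
      _ ≤ c n t := ENNReal.sum_le_tsum _
  have hle : ∀ t, ({x | x ∈ s ∧ F x = t}.encard : ℝ≥0∞) ≤ liminf (fun n ↦ c n t) atTop := by
    intro t
    rcases Set.finite_or_infinite {x | x ∈ s ∧ F x = t} with h | h
    · rw [h.encard_eq_coe_toFinset_card]
      simpa using hfin t h.toFinset (by simp)
    · rw [h.encard_eq]
      refine (ENNReal.eq_top_of_forall_nnreal_le fun r ↦ ?_).ge
      obtain ⟨n, hn⟩ := exists_nat_ge r
      obtain ⟨T, hT, hTn⟩ := h.exists_subset_card_eq n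
      refine le_trans ?_ (hfin t T fun x hx ↦ hT hx)
      rw [hTn]
      exact_mod_cast hn
  calc ∫⁻ t, ({x | x ∈ s ∧ F x = t}.encard : ℝ≥0∞)
      ≤ ∫⁻ t, liminf (fun n ↦ c n t) atTop := lintegral_mono hle
    _ ≤ liminf (fun n ↦ ∫⁻ t, c n t) atTop := lintegral_liminf_le hcm
    _ ≤ ∫⁻ x in s, ENNReal.ofReal |F' x| :=
        liminf_le_of_frequently_le' (Frequently.of_forall hc)

/-- Almost every level set of a continuous function on a compact set is finite if the function is
differentiable outside a countable set: by Sard's theorem, almost every level is a regular value,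
and the level set of a regular value is compact and discrete. -/
theorem ae_finite_level {F F' : ℝ → ℝ} {K s : Set ℝ} (hK : IsCompact K) (hFK : ContinuousOn F K)
    (hs : (K \ s).Countable) (hF : ∀ x ∈ s, HasDerivAt F (F' x) x) :
    ∀ᵐ t : ℝ, {x | x ∈ K ∧ F x = t}.Finite := by
  have h1 : volume (F '' (K \ s)) = 0 := (hs.image F).measure_zero _
  have h2 : volume (F '' {x | x ∈ s ∧ F' x = 0}) = 0 := by
    refine addHaar_image_eq_zero_of_det_fderivWithin_eq_zero volume
      (fun x hx ↦ (hF x hx.1).hasDerivWithinAt.hasFDerivWithinAt) fun x hx ↦ ?_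
    simpa using hx.2
  filter_upwards [measure_eq_zero_iff_ae_notMem.1 h1, measure_eq_zero_iff_ae_notMem.1 h2]
    with t ht1 ht2
  have hc : IsCompact {x | x ∈ K ∧ F x = t} :=
    hK.of_isClosed_subset (hFK.preimage_isClosed_of_isClosed hK.isClosed isClosed_singleton)
      fun x hx ↦ hx.1
  refine hc.finite (isDiscrete_iff_nhdsNE.2 ?_)
  rintro x ⟨hxK, hxt⟩
  have hxs : x ∈ s := by_contra fun h ↦ ht1 ⟨x, ⟨hxK, h⟩, hxt⟩
  have hx0 : F' x ≠ 0 := fun h ↦ ht2 ⟨x, ⟨hxs, h⟩, hxt⟩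
  rw [Filter.inf_principal_eq_bot]
  filter_upwards [(hF x hxs).eventually_ne (c := t) hx0] with y hy hy'
  exact hy hy'.2

/-! ### Piecewise `C¹` functions -/

theorem PiecewiseC1.exists_finite_differentiableAt {E : Type*} [NormedAddCommGroup E]
    [NormedSpace ℝ E] {γ : I → E} (hγ : PiecewiseC1 γ) :
    ∃ D : Set ℝ, D.Finite ∧
      ∀ x ∈ Set.Icc (0 : ℝ) 1 \ D, DifferentiableAt ℝ (Set.IccExtend zero_le_one γ) x := by
  obtain ⟨-, k, p, q, hcover, hC⟩ := hγ
  refine ⟨Set.range p ∪ Set.range q, (Set.finite_range p).union (Set.finite_range q), ?_⟩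
  rintro x ⟨hx, hxD⟩
  rw [← hcover, Set.mem_iUnion] at hx
  obtain ⟨i, hi⟩ := hx
  have hxi : x ∈ Set.Ioo (p i) (q i) :=
    ⟨lt_of_le_of_ne hi.1 fun h ↦ hxD (.inl ⟨i, h⟩),
      lt_of_le_of_ne hi.2 fun h ↦ hxD (.inr ⟨i, h.symm⟩)⟩
  exact ((hC i).differentiableOn one_ne_zero).differentiableAt (isOpen_Ioo.mem_nhds hxi)

theorem encard_level_eq (f : I → ℝ) (t : ℝ) :
    {x | f x = t}.encard =
      {x | x ∈ Set.Icc (0 : ℝ) 1 ∧ Set.IccExtend zero_le_one f x = t}.encard := by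
  rw [← Subtype.val_injective.encard_image]
  congr 1
  ext x
  constructor
  · rintro ⟨y, hy, rfl⟩
    exact ⟨y.2, by rwa [Set.IccExtend_val]⟩
  · rintro ⟨hx, hxt⟩
    exact ⟨⟨x, hx⟩, by rwa [Set.IccExtend_of_mem _ _ hx] at hxt, rfl⟩

theorem lintegral_encard_level_le_variation {f : I → ℝ} {D : Set ℝ} (hD : D.Finite)
    (hf : ∀ x ∈ Set.Icc (0 : ℝ) 1 \ D, DifferentiableAt ℝ (Set.IccExtend zero_le_one f) x) :
    ∫⁻ t, ({x | f x = t}.encard : ℝ≥0∞) ≤ variation f := by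
  set F := Set.IccExtend zero_le_one f
  -- Only finitely many levels are attained at a point of `D` or at an endpoint.
  have hnull : ∀ᵐ t : ℝ, t ∉ F '' (D ∪ {0, 1}) :=
    measure_eq_zero_iff_ae_notMem.1
      ((((hD.union (Set.toFinite {0, 1})).image F).countable).measure_zero _)
  calc ∫⁻ t, ({x | f x = t}.encard : ℝ≥0∞)
      ≤ ∫⁻ t, ({x | x ∈ Set.Ioo (0 : ℝ) 1 \ D ∧ F x = t}.encard : ℝ≥0∞) := by
        refine lintegral_mono_ae (hnull.mono fun t ht ↦ ?_)
        rw [encard_level_eq]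
        refine ENat.toENNReal_mono (Set.encard_le_encard ?_)
        rintro x ⟨hx, hxt⟩
        have hx' : x ∉ D ∪ {0, 1} := fun h ↦ ht ⟨x, h, hxt⟩
        simp only [Set.mem_union, Set.mem_insert_iff, Set.mem_singleton_iff, not_or] at hx'
        exact ⟨⟨⟨lt_of_le_of_ne hx.1 (Ne.symm hx'.2.1), lt_of_le_of_ne hx.2 hx'.2.2⟩, hx'.1⟩, hxt⟩
    _ ≤ ∫⁻ x in Set.Ioo (0 : ℝ) 1 \ D, ENNReal.ofReal |deriv F x| :=
        lintegral_encard_level_le (measurableSet_Ioo.diff hD.measurableSet) fun x hx ↦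
          (hf x ⟨Set.Ioo_subset_Icc_self hx.1, hx.2⟩).hasDerivAt.hasDerivWithinAt
    _ ≤ variation f := lintegral_mono_set Set.sdiff_subset

theorem ae_finite_level_of_finite_compl {f : I → ℝ} (hfc : Continuous f) {D : Set ℝ}
    (hD : D.Finite)
    (hf : ∀ x ∈ Set.Icc (0 : ℝ) 1 \ D, DifferentiableAt ℝ (Set.IccExtend zero_le_one f) x) :
    ∀ᵐ t : ℝ, {x | f x = t}.Finite := by
  have := ae_finite_level (s := Set.Icc 0 1 \ D) isCompact_Icc
    (hfc.Icc_extend' (h := zero_le_one)).continuousOn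
    (hD.countable.mono fun x hx ↦ by_contra fun h ↦ hx.2 ⟨hx.1, h⟩)
    fun x hx ↦ (hf x hx).hasDerivAt
  filter_upwards [this] with t ht
  rwa [← Set.encard_lt_top_iff, encard_level_eq, Set.encard_lt_top_iff]

/-! ### The Euler characteristic transform of a curve -/

theorem proposition3p4 {d : ℕ} (γ : I → EuclideanSpace ℝ (Fin d)) (hγ : PiecewiseC1 γ)
    (v : Metric.sphere (0 : EuclideanSpace ℝ (Fin d)) 1) (f : I → ℝ)
    (hf : ∀ x, f x = inner ℝ (v : EuclideanSpace ℝ (Fin d)) (γ x)) (a b : ℝ)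
    (ha : IsLeast (Set.range f) a) (hb : IsGreatest (Set.range f) b) :
    (Measurable fun t : ℝ => extAbs (ECT γ v t)) ∧
    (∫⁻ t in Set.Icc a b, extAbs (ECT γ v t)) ≤ variation f ∧
    (∀ t : ℝ, b ≤ t → ECT γ v t = 1) ∧
    (∀ t : ℝ, t < a → ECT γ v t = 0) ∧
    (∀ᵐ t : ℝ, ECT γ v t ≠ ⊤) := by
  have hfγ : f = fun x ↦ inner ℝ (v : EuclideanSpace ℝ (Fin d)) (γ x) := funext hf
  have hfc : Continuous f := hfγ ▸ continuous_const.inner hγ.1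
  have hECT : ∀ t, ECT γ v t = eulerCharacteristic {x | f x ≤ t} := fun t ↦ by
    have : γ ⁻¹' {x | inner ℝ x (v : EuclideanSpace ℝ (Fin d)) ≤ t} = {x | f x ≤ t} := by
      ext x
      simp [hf, real_inner_comm]
    rw [ECT, this]
  have habs : ∀ t, extAbs (ECT γ v t) = (ENat.card (ConnectedComponents {x | f x ≤ t}) : ℝ≥0∞) :=
    fun t ↦ by rw [hECT, extAbs_eulerCharacteristic]
  obtain ⟨D, hD, hγD⟩ := hγ.exists_finite_differentiableAt
  have hfD : ∀ x ∈ Set.Icc (0 : ℝ) 1 \ D,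
      DifferentiableAt ℝ (Set.IccExtend zero_le_one f) x := fun x hx ↦ by
    have : Set.IccExtend zero_le_one f = fun x ↦
        inner ℝ (v : EuclideanSpace ℝ (Fin d)) (Set.IccExtend zero_le_one γ x) := by
      rw [hfγ]; rfl
    rw [this]
    exact (differentiableAt_const _).inner ℝ (hγD x hx)
  have hlevel : ∀ t < b, ENat.card (ConnectedComponents {x | f x ≤ t}) ≤ {x | f x = t}.encard := by
    intro t ht
    obtain ⟨z, hz⟩ := hb.1
    exact card_components_sublevel_le hfc ⟨z, hz ▸ ht⟩
  have htop : ∀ t, b ≤ t → ECT γ v t = 1 := by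
    intro t ht
    have hall : ∀ x, f x ≤ t := fun x ↦ (hb.2 ⟨x, rfl⟩).trans ht
    have : Subsingleton (ConnectedComponents {x | f x ≤ t}) := ⟨fun c c' ↦ by
      obtain ⟨x, rfl⟩ := ConnectedComponents.surjective_coe c
      obtain ⟨y, rfl⟩ := ConnectedComponents.surjective_coe c'
      exact connectedComponents_mk_eq_iff.2 fun z _ ↦ hall z⟩
    have : Nonempty (ConnectedComponents {x | f x ≤ t}) :=
      ⟨ConnectedComponents.mk ⟨0, hall 0⟩⟩
    rw [hECT, eulerCharacteristic_of_finite, Nat.card_of_subsingleton (Classical.arbitrary _)]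
    simp
  have hbot : ∀ t, t < a → ECT γ v t = 0 := by
    intro t ht
    have : IsEmpty {x | f x ≤ t} := ⟨fun x ↦ ((ha.2 ⟨x, rfl⟩).trans x.2).not_gt ht⟩
    have : IsEmpty (ConnectedComponents {x | f x ≤ t}) := ⟨fun c ↦ by
      obtain ⟨x, -⟩ := ConnectedComponents.surjective_coe c
      exact isEmptyElim x⟩
    rw [hECT, eulerCharacteristic_of_finite, Nat.card_of_isEmpty]
    simp
  refine ⟨?_, ?_, htop, hbot, ?_⟩
  · simp only [habs]
    exact (measurable_of_countable ENat.toENNReal).comp (measurable_card_components_sublevel hfc)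
  · calc ∫⁻ t in Set.Icc a b, extAbs (ECT γ v t)
        = ∫⁻ t in Set.Ico a b, extAbs (ECT γ v t) := by
          rw [restrict_Ico_eq_restrict_Icc]
      _ ≤ ∫⁻ t in Set.Ico a b, ({x | f x = t}.encard : ℝ≥0∞) := by
          refine setLIntegral_mono' measurableSet_Ico fun t ht ↦ ?_
          rw [habs]
          exact ENat.toENNReal_mono (hlevel t ht.2)
      _ ≤ ∫⁻ t, ({x | f x = t}.encard : ℝ≥0∞) := setLIntegral_le_lintegral _ _
      _ ≤ variation f := lintegral_encard_level_le_variation hD hfD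
  · filter_upwards [ae_finite_level_of_finite_compl hfc hD hfD] with t ht
    rcases le_or_gt b t with hbt | htb
    · rw [htop t hbt]
      exact WithTop.one_ne_top
    · have : Finite (ConnectedComponents {x | f x ≤ t}) := by
        rw [← ENat.card_lt_top]
        exact (hlevel t htb).trans_lt (Set.encard_lt_top_iff.2 ht)
      rw [hECT, eulerCharacteristic_of_finite]
      exact WithTop.coe_ne_top
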